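/- For a monoid $M$, let $\operatorname{Rank}(M)$ denote the minimal cardinality of a generating set of $M$ (as a monoid). Let $G$ be a finite Dedekind group, that is, a finite group all of whose subgroups are normal, and let $A$ be a finite set of size $q\ge 2$, with the discrete topology. Let $G$ act on $A^G$ (with the product topology) by $(g\cdot x)(h)=x(g^{-1}h)$, and let $\operatorname{End}(A^G)$ be the monoid, under composition, of all continuous maps $\tau:A^G\to A^G$ such that $\tau(g\cdot x)=g\cdot\tau(x)$ for all $g\in G$, $x\in A^G$. Let $r$ be the number of conjugacy classes of subgroups of $G$; for $i\ge 1$ let $r_i$ be the number of conjugacy classes of subgroups of $G$ of index $i$; and let $r_P:=\sum_{p} r_p$, the sum being over the prime divisors $p$ of $|G|$. Then \[ \operatorname{Rank}(\operatorname{End}(A^G))\le \begin{cases} (r-r_P-1)\operatorname{Rank}(G)+\tfrac12 r(r+5)-2r_2-1, & \text{if } q=2,\\[2pt] (r-r_P-1)\operatorname{Rank}(G)+\tfrac12 r(r+5), & \text{otherwise.} \end{cases} \] -/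

import Mathlib

namespace FullShift

/-- The rank of a finitely generated monoid: the minimal cardinality of a generating set, where
`T` generates `M` if the smallest submonoid containing `T` is all of `M`. -/
noncomputable def monoidRank (M : Type*) [Monoid M] [Monoid.FG M] : ℕ :=
  sInf {n : ℕ | ∃ T : Finset M, T.card = n ∧ Submonoid.closure (T : Set M) = ⊤}

/-- The minimum in `monoidRank` is attained. -/
theorem monoidRank_spec (M : Type*) [Monoid M] [h : Monoid.FG M] :
    ∃ T : Finset M, T.card = monoidRank M ∧ Submonoid.closure (T : Set M) = ⊤ := by
  obtain ⟨T, hT⟩ := Monoid.fg_def.mp h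
  exact Nat.sInf_mem
    (s := {n : ℕ | ∃ T : Finset M, T.card = n ∧ Submonoid.closure (T : Set M) = ⊤})
    ⟨T.card, T, rfl, hT⟩

/-- The shift action of a group `G` on `A^G`: `(g • x)(h) = x(g⁻¹ h)`. -/
def shift {G A : Type*} [Group G] (g : G) (x : G → A) : G → A :=
  fun h => x (g⁻¹ * h)

/-- The monoid `End(A^G)`, under composition, of the self-maps of `A^G` that are continuous (for the
product topology) and commute with the shift action. -/
def shiftEnd (G A : Type*) [Group G] [TopologicalSpace A] :
    Submonoid (Function.End (G → A)) where
  carrier := {τ : (G → A) → (G → A) |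
    Continuous τ ∧ ∀ (g : G) (x : G → A), τ (shift g x) = shift g (τ x)}
  one_mem' := ⟨continuous_id, fun _ _ => rfl⟩
  mul_mem' := by
    rintro σ τ ⟨hσ, hσ'⟩ ⟨hτ, hτ'⟩
    refine ⟨hσ.comp hτ, fun g x => ?_⟩
    change σ (τ (shift g x)) = shift g (σ (τ x))
    rw [hτ', hσ']

instance finite_shiftEnd (G A : Type*) [Group G] [TopologicalSpace A] [Finite G] [Finite A] :
    Finite (shiftEnd G A) :=
  have : Finite (Function.End (G → A)) := inferInstanceAs (Finite ((G → A) → (G → A)))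
  inferInstanceAs (Finite {τ : Function.End (G → A) // τ ∈ shiftEnd G A})

instance fg_shiftEnd (G A : Type*) [Group G] [TopologicalSpace A] [Finite G] [Finite A] :
    Monoid.FG (shiftEnd G A) :=
  Monoid.fg_of_finite

/-- A Dedekind group: all subgroups are normal. -/
def IsDedekindGroup (G : Type*) [Group G] : Prop :=
  ∀ H : Subgroup G, H.Normal

/-- The conjugacy class `[H]` of a subgroup, i.e. the set of all `g⁻¹ H g`. -/
def conjClass {G : Type*} [Group G] (H : Subgroup G) : Set (Subgroup G) :=
  {K | ∃ g : G, H.map (MulAut.conj g⁻¹).toMonoidHom = K}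

/-- `r(G)`: the number of conjugacy classes of subgroups of `G`. -/
noncomputable def numClasses (G : Type*) [Group G] : ℕ :=
  {C : Set (Subgroup G) | ∃ H : Subgroup G, conjClass H = C}.ncard

/-- `r_i(G)`: the number of conjugacy classes of subgroups of index `i` in `G`. -/
noncomputable def numClassesOfIndex (G : Type*) [Group G] (i : ℕ) : ℕ :=
  {C : Set (Subgroup G) | ∃ H : Subgroup G, H.index = i ∧ conjClass H = C}.ncard

/-- `r_P(G)`: the sum of `r_p(G)` over the prime divisors `p` of `|G|`. -/
noncomputable def numClassesOfPrimeIndex (G : Type*) [Group G] : ℕ :=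
  ∑ p ∈ (Nat.card G).primeFactors, numClassesOfIndex G p

end FullShift

/-! Forget the topology: with G finite and A discrete, `shiftEnd G A` is the monoid of equivariant
self-maps of the finite G-set X = A^G. Sort X by stabilizer. All subgroups being normal, points of
one orbit share a stabilizer, and an equivariant map can only enlarge stabilizers.

The automorphisms of X form the product, over subgroups H, of the wreath products of G/H with the
symmetric group on the orbits of stabilizer H. Everything else comes from automorphisms and
collapses of one orbit onto another (`mem_of_injective_mem_of_collapse_mem`). Up to automorphisms, a
collapse depends only on its pair of stabilizers H ≤ K (`exists_finset_collapse`).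

Now count. Each H costs a collapse within its stratum, a transposition, a cycle, and twists that
together with H generate G, at most Rank(G) + 3 maps. One twist can be folded into the cycle. If H
has prime index it is maximal, so that single twist suffices and the cost is 3; for H = G no twist
is needed, again 3. Each pair H < K costs one collapse, and there are at most r(r-1)/2 pairs. Since
3r + r(r-1)/2 = r(r+5)/2, the general bound follows.

For q = 2, only two configurations are fixed by G, which saves 1; each subgroup of index 2 has a
single orbit, hence neither transposition nor collapse, which saves 2. -/

namespace FullShift

open MulAction

/-! ### Equivariant maps prescribed on chosen orbits -/

section Override

variable (G : Type*) {X ι : Type*} [Group G] [MulAction G X]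

/-- The monoid of all self-maps of a `G`-set that commute with the action. -/
def equivariantEnd (X : Type*) [MulAction G X] : Submonoid (Function.End X) where
  carrier := {τ : X → X | ∀ (g : G) (x : X), τ (g • x) = g • τ x}
  one_mem' := fun _ _ => rfl
  mul_mem' := by
    intro σ τ hσ hτ g x
    change σ (τ (g • x)) = g • σ (τ x)
    rw [hτ, hσ]

/-- A family of points lying in pairwise distinct orbits. -/
def OrbitIndependent (x : ι → X) : Prop :=
  ∀ (i j : ι) (g : G), g • x i = x j → i = j

open Classical in
/-- The map that sends `g • x i` to `g • f i` and agrees with `τ` off the orbits of the `x i`. -/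
noncomputable def override (τ : Function.End X) (x f : ι → X) : Function.End X :=
  fun u => if h : ∃ p : ι × G, p.2 • x p.1 = u then h.choose.2 • f h.choose.1 else τ u

variable {G}

theorem end_mul_apply (σ τ : Function.End X) (u : X) : (σ * τ) u = σ (τ u) := rfl

theorem OrbitIndependent.const (x : X) : OrbitIndependent G (fun _ : Unit => x) :=
  fun _ _ _ _ => rfl

/-- The choice in `override` is harmless: independence of the orbits determines the index, and two
admissible group elements differ by an element of the stabilizer of `x i`, which also fixes `f i`.
-/
theorem override_smul (τ : Function.End X) {x f : ι → X} (hx : OrbitIndependent G x)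
    (hf : ∀ i, stabilizer G (x i) ≤ stabilizer G (f i)) (g : G) (i : ι) :
    override G τ x f (g • x i) = g • f i := by
  have h : ∃ p : ι × G, p.2 • x p.1 = g • x i := ⟨(i, g), rfl⟩
  unfold override
  rw [dif_pos h]
  have hs := h.choose_spec
  generalize h.choose = p at hs
  obtain ⟨j, k⟩ := p
  dsimp only at hs ⊢
  obtain rfl : j = i := hx j i (g⁻¹ * k) (by rw [mul_smul, hs, inv_smul_smul])
  have hm : g⁻¹ * k ∈ stabilizer G (x j) := by
    rw [mem_stabilizer_iff, mul_smul, hs, inv_smul_smul]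
  have := hf j hm
  rw [mem_stabilizer_iff, mul_smul, inv_smul_eq_iff] at this
  exact this

theorem override_apply (τ : Function.End X) {x f : ι → X} (hx : OrbitIndependent G x)
    (hf : ∀ i, stabilizer G (x i) ≤ stabilizer G (f i)) (i : ι) :
    override G τ x f (x i) = f i := by
  simpa using override_smul τ hx hf 1 i

theorem override_of_forall_ne (τ : Function.End X) (x f : ι → X) {u : X}
    (hu : ∀ i (g : G), g • x i ≠ u) : override G τ x f u = τ u := by
  unfold override
  rw [dif_neg]
  rintro ⟨p, hp⟩
  exact hu _ _ hp

theorem override_mem {τ : Function.End X} (hτ : τ ∈ equivariantEnd G X) {x f : ι → X}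
    (hx : OrbitIndependent G x) (hf : ∀ i, stabilizer G (x i) ≤ stabilizer G (f i)) :
    override G τ x f ∈ equivariantEnd G X := by
  intro g u
  by_cases hu : ∃ i, ∃ h : G, h • x i = u
  · obtain ⟨i, h, rfl⟩ := hu
    rw [← mul_smul, override_smul τ hx hf, override_smul τ hx hf, mul_smul]
  · push Not at hu
    rw [override_of_forall_ne τ x f hu, override_of_forall_ne, hτ]
    intro i h hh
    exact hu i (g⁻¹ * h) (by rw [mul_smul, hh, inv_smul_smul])

theorem equivariantEnd_ext {σ τ : Function.End X} (hσ : σ ∈ equivariantEnd G X)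
    (hτ : τ ∈ equivariantEnd G X) (x : ι → X) (h : ∀ i, σ (x i) = τ (x i))
    (h' : ∀ u, (∀ i (g : G), g • x i ≠ u) → σ u = τ u) : σ = τ := by
  funext u
  by_cases hu : ∃ i, ∃ g : G, g • x i = u
  · obtain ⟨i, g, rfl⟩ := hu
    rw [hσ, hτ, h]
  · push Not at hu
    exact h' u hu

theorem stabilizer_le_of_equivariant {τ : Function.End X} (hτ : τ ∈ equivariantEnd G X) (u : X) :
    stabilizer G u ≤ stabilizer G (τ u) := by
  intro g hg
  rw [mem_stabilizer_iff] at hg ⊢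
  rw [← hτ, hg]

theorem stabilizer_eq_of_injective {τ : Function.End X} (hτ : τ ∈ equivariantEnd G X)
    (hi : Function.Injective τ) (u : X) : stabilizer G (τ u) = stabilizer G u := by
  refine le_antisymm (fun g hg => ?_) (stabilizer_le_of_equivariant hτ u)
  rw [mem_stabilizer_iff] at hg ⊢
  exact hi (by rw [hτ, hg])

/-- Conjugating by an automorphism transports the data of an override. The intertwining form needs
no inverse of `φ`. -/
theorem override_mul_eq_mul_override {φ : Function.End X} (hφ : φ ∈ equivariantEnd G X)
    (hi : Function.Injective φ) {x f : ι → X} (hx : OrbitIndependent G x)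
    (hf : ∀ i, stabilizer G (x i) ≤ stabilizer G (f i)) :
    override G 1 (fun i => φ (x i)) (fun i => φ (f i)) * φ = φ * override G 1 x f := by
  have hx' : OrbitIndependent G (fun i => φ (x i)) := by
    intro i j g h
    dsimp only at h
    rw [← hφ] at h
    exact hx i j g (hi h)
  have hf' : ∀ i, stabilizer G (φ (x i)) ≤ stabilizer G (φ (f i)) := by
    intro i
    rw [stabilizer_eq_of_injective hφ hi, stabilizer_eq_of_injective hφ hi]
    exact hf i
  refine equivariantEnd_ext (mul_mem (override_mem (one_mem _) hx' hf') hφ)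
    (mul_mem hφ (override_mem (one_mem _) hx hf)) x (fun i => ?_) (fun u hu => ?_)
  · rw [end_mul_apply, end_mul_apply, override_apply 1 hx hf]
    exact override_apply 1 hx' hf' i
  · rw [end_mul_apply, end_mul_apply, override_of_forall_ne _ _ _ hu, override_of_forall_ne]
    · rfl
    · intro i g h
      rw [← hφ] at h
      exact hu i g (hi h)

end Override

/-! ### Cancelling injective maps inside a submonoid -/

section Cancel

theorem injective_of_mul_eq_one {X : Type*} {a b : Function.End X} (h : b * a = 1) : Function.Injective a :=
  Function.LeftInverse.injective (g := b) fun u => congrFun h u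

theorem injective_mul {X : Type*} {a b : Function.End X} (ha : Function.Injective a)
    (hb : Function.Injective b) : Function.Injective (a * b) :=
  ha.comp hb

variable {X : Type*} [Finite X]

/-- An injective self-map of a finite set is a permutation of finite order, so its inverse is one of
its powers. Submonoids are therefore closed under inverses of their injective members. -/
theorem exists_pow_mul_eq_one {a : Function.End X} (ha : Function.Injective a) :
    ∃ n : ℕ, a ^ n * a = 1 ∧ a * a ^ n = 1 := by
  let e : Equiv.Perm X := Equiv.ofBijective a (Finite.injective_iff_bijective.mp ha)
  let v := Equiv.Perm.equivUnitsEnd e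
  have hv : (v : Function.End X) = a := rfl
  have : Finite (Function.End X)ˣ := Finite.of_equiv _ (Equiv.Perm.equivUnitsEnd (α := X)).toEquiv
  obtain ⟨n, hn, h⟩ := (isOfFinOrder_of_finite v).exists_pow_eq_one
  obtain ⟨m, rfl⟩ : ∃ m, n = m + 1 := ⟨n - 1, by omega⟩
  have h' := congrArg Units.val h
  rw [Units.val_pow_eq_pow_val, hv, Units.val_one] at h'
  exact ⟨m, by rw [← pow_succ, h'], by rw [← pow_succ', h']⟩

theorem mem_of_mul_mem_of_left {S : Submonoid (Function.End X)} {a b : Function.End X}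
    (hi : Function.Injective a) (ha : a ∈ S) (hab : a * b ∈ S) : b ∈ S := by
  obtain ⟨n, hn, -⟩ := exists_pow_mul_eq_one hi
  have := mul_mem (pow_mem ha n) hab
  rwa [← mul_assoc, hn, one_mul] at this

theorem mem_of_mul_mem_of_right {S : Submonoid (Function.End X)} {a b : Function.End X}
    (hi : Function.Injective a) (ha : a ∈ S) (hab : b * a ∈ S) : b ∈ S := by
  obtain ⟨n, -, hn⟩ := exists_pow_mul_eq_one hi
  have := mul_mem hab (pow_mem ha n)
  rwa [mul_assoc, hn, mul_one] at this

theorem override_comp_mem {G ι : Type*} [Group G] [MulAction G X] {S : Submonoid (Function.End X)}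
    {φ : Function.End X} (hφ : φ ∈ equivariantEnd G X) (hi : Function.Injective φ) (hS : φ ∈ S)
    {x f : ι → X} (hx : OrbitIndependent G x) (hf : ∀ i, stabilizer G (x i) ≤ stabilizer G (f i))
    (h : override G 1 x f ∈ S) : override G 1 (fun i => φ (x i)) (fun i => φ (f i)) ∈ S := by
  refine mem_of_mul_mem_of_right hi hS ?_
  rw [override_mul_eq_mul_override hφ hi hx hf]
  exact mul_mem hS h

end Cancel

/-! ### Collapses, twists and relabellings of orbits -/

section Elementary

variable (G : Type*) {X ι : Type*} [Group G] [MulAction G X]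

/-- The map sending `g • x` to `g • y` and fixing every point off the orbit of `x`. -/
noncomputable def collapse (x y : X) : Function.End X :=
  override G 1 (fun _ : Unit => x) (fun _ => y)

/-- The map sending `h • x` to `h • g • x` and fixing every point off the orbit of `x`. -/
noncomputable def twist (x : X) (g : G) : Function.End X :=
  collapse G x (g • x)

/-- The map permuting the orbits of the points `x i` as prescribed by `p`. -/
noncomputable def relabel (x : ι → X) (p : Equiv.Perm ι) : Function.End X :=
  override G 1 x (fun i => x (p i))

variable {G}

/-- The stabilizer of `g • x` is a conjugate of that of `x`, hence equal to it by normality. This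
makes twists well defined. -/
theorem stabilizer_smul_of_normal (hG : IsDedekindGroup G) (g : G) (x : X) :
    stabilizer G (g • x) = stabilizer G x := by
  ext h
  have := (hG (stabilizer G x)).mem_comm_iff (a := g⁻¹) (b := h * g)
  rw [mul_inv_cancel_right] at this
  rw [← this]
  simp only [mem_stabilizer_iff, mul_smul, inv_smul_eq_iff]

section Collapse

variable {x y : X} (h : stabilizer G x ≤ stabilizer G y)
include h

theorem collapse_smul (g : G) : collapse G x y (g • x) = g • y :=
  override_smul 1 (.const x) (fun _ => h) g ()

theorem collapse_apply : collapse G x y x = y :=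
  override_apply 1 (.const x) (fun _ => h) ()

theorem collapse_mem : collapse G x y ∈ equivariantEnd G X :=
  override_mem (one_mem _) (.const x) fun _ => h

theorem collapse_comp_mem [Finite X] {S : Submonoid (Function.End X)}
    {φ : Function.End X} (hφ : φ ∈ equivariantEnd G X) (hi : Function.Injective φ) (hS : φ ∈ S)
    (hc : collapse G x y ∈ S) : collapse G (φ x) (φ y) ∈ S :=
  override_comp_mem hφ hi hS (.const x) (fun _ => h) hc

end Collapse

theorem collapse_of_ne {x y u : X} (hu : ∀ g : G, g • x ≠ u) : collapse G x y u = u :=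
  override_of_forall_ne 1 _ _ fun _ => hu

theorem collapse_ext {x y : X} (h : stabilizer G x ≤ stabilizer G y) {σ : Function.End X}
    (hσ : σ ∈ equivariantEnd G X) (h1 : σ x = y) (h2 : ∀ u, (∀ g : G, g • x ≠ u) → σ u = u) :
    collapse G x y = σ := by
  refine equivariantEnd_ext (collapse_mem h) hσ (fun _ : Unit => x) (fun _ => ?_) (fun u hu => ?_)
  · rw [h1, collapse_apply h]
  · rw [collapse_of_ne (hu ()), h2 u (hu ())]

section Twist

variable (hG : IsDedekindGroup G) (x : X)
include hG

theorem twist_smul (g h : G) : twist G x g (h • x) = h • g • x :=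
  collapse_smul (stabilizer_smul_of_normal hG g x).ge h

theorem twist_apply (g : G) : twist G x g x = g • x :=
  collapse_apply (stabilizer_smul_of_normal hG g x).ge

theorem twist_mem (g : G) : twist G x g ∈ equivariantEnd G X :=
  collapse_mem (stabilizer_smul_of_normal hG g x).ge

omit hG in
theorem twist_of_ne {x u : X} (g : G) (hu : ∀ g : G, g • x ≠ u) : twist G x g u = u :=
  collapse_of_ne hu

/-- The order reverses because a twist multiplies on the right of the group element that locates a
point in the orbit. -/
theorem twist_mul_twist (g h : G) : twist G x g * twist G x h = twist G x (h * g) := by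
  refine (collapse_ext (stabilizer_smul_of_normal hG _ x).ge
    (mul_mem (twist_mem hG x g) (twist_mem hG x h)) ?_ fun u hu => ?_).symm
  · rw [end_mul_apply, twist_apply hG, twist_smul hG, mul_smul]
  · rw [end_mul_apply, twist_of_ne h hu, twist_of_ne g hu]

omit hG in
theorem twist_of_mem {g : G} (hg : g ∈ stabilizer G x) : twist G x g = 1 := by
  unfold twist
  rw [mem_stabilizer_iff.mp hg]
  exact collapse_ext le_rfl (one_mem _) rfl fun _ _ => rfl

theorem twist_injective (g : G) : Function.Injective (twist G x g) := by
  refine injective_of_mul_eq_one (b := twist G x g⁻¹) ?_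
  rw [twist_mul_twist hG, mul_inv_cancel, twist_of_mem x (one_mem _)]

theorem twist_comp_mem [Finite X] {S : Submonoid (Function.End X)}
    {φ : Function.End X} (hφ : φ ∈ equivariantEnd G X) (hi : Function.Injective φ) (hS : φ ∈ S)
    {g : G} (hc : twist G x g ∈ S) : twist G (φ x) g ∈ S := by
  have := collapse_comp_mem (stabilizer_smul_of_normal hG g x).ge hφ hi hS hc
  rwa [hφ] at this

end Twist

section Relabel

variable {x : ι → X} (hx : OrbitIndependent G x)
  (hs : ∀ i j, stabilizer G (x i) = stabilizer G (x j))
include hx hs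

theorem relabel_smul (p : Equiv.Perm ι) (g : G) (i : ι) :
    relabel G x p (g • x i) = g • x (p i) :=
  override_smul 1 hx (fun _ => (hs _ _).le) g i

theorem relabel_apply (p : Equiv.Perm ι) (i : ι) : relabel G x p (x i) = x (p i) :=
  override_apply 1 hx (fun _ => (hs _ _).le) i

theorem relabel_mem (p : Equiv.Perm ι) : relabel G x p ∈ equivariantEnd G X :=
  override_mem (one_mem _) hx fun _ => (hs _ _).le

omit hx hs in
theorem relabel_of_ne (p : Equiv.Perm ι) {u : X} (hu : ∀ i (g : G), g • x i ≠ u) :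
    relabel G x p u = u :=
  override_of_forall_ne 1 _ _ hu

theorem relabel_ext (p : Equiv.Perm ι) {σ : Function.End X} (hσ : σ ∈ equivariantEnd G X)
    (h1 : ∀ i, σ (x i) = x (p i)) (h2 : ∀ u, (∀ i (g : G), g • x i ≠ u) → σ u = u) :
    relabel G x p = σ := by
  refine equivariantEnd_ext (relabel_mem hx hs p) hσ x (fun i => ?_) (fun u hu => ?_)
  · rw [h1, relabel_apply hx hs]
  · rw [relabel_of_ne p hu, h2 u hu]

theorem relabel_one : relabel G x 1 = 1 :=
  relabel_ext hx hs 1 (one_mem _) (fun _ => rfl) fun _ _ => rfl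

theorem relabel_mul (p q : Equiv.Perm ι) :
    relabel G x (p * q) = relabel G x p * relabel G x q := by
  refine relabel_ext hx hs _ (mul_mem (relabel_mem hx hs p) (relabel_mem hx hs q))
    (fun i => ?_) fun u hu => ?_
  · rw [end_mul_apply, relabel_apply hx hs, relabel_apply hx hs, Equiv.Perm.mul_apply]
  · rw [end_mul_apply, relabel_of_ne q hu, relabel_of_ne p hu]

theorem relabel_injective (p : Equiv.Perm ι) : Function.Injective (relabel G x p) := by
  refine injective_of_mul_eq_one (b := relabel G x p⁻¹) ?_
  rw [← relabel_mul hx hs, inv_mul_cancel, relabel_one hx hs]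

end Relabel

/-- Two points with the same stabilizer are exchanged by an automorphism that fixes
all the points off their orbits. -/
theorem exists_automorphism_apply_eq (hG : IsDedekindGroup G) {x y : X}
    (h : stabilizer G x = stabilizer G y) :
    ∃ φ ∈ equivariantEnd G X, Function.Injective φ ∧ φ x = y ∧
      ∀ u, (∀ g : G, g • x ≠ u) → (∀ g : G, g • y ≠ u) → φ u = u := by
  by_cases hxy : ∃ g : G, g • x = y
  · obtain ⟨g, rfl⟩ := hxy
    exact ⟨twist G x g, twist_mem hG x g, twist_injective hG x g, twist_apply hG x g,
      fun u hu _ => twist_of_ne g hu⟩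
  · push Not at hxy
    have hi : OrbitIndependent G ![x, y] := by
      intro i j g hg
      fin_cases i <;> fin_cases j <;> first | rfl | skip
      · exact absurd hg (hxy g)
      · exact absurd (eq_inv_smul_iff.mpr hg).symm (hxy g⁻¹)
    have hs : ∀ i j, stabilizer G (![x, y] i) = stabilizer G (![x, y] j) := by
      intro i j
      fin_cases i <;> fin_cases j <;> simp [h]
    refine ⟨relabel G ![x, y] (Equiv.swap 0 1), relabel_mem hi hs _, relabel_injective hi hs _,
      ?_, fun u hu hu' => relabel_of_ne _ fun i => ?_⟩
    · exact relabel_apply hi hs (Equiv.swap 0 1) 0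
    · fin_cases i
      · exact hu
      · exact hu'

end Elementary

/-! ### The wreath product acting on one stabilizer stratum -/

section Wreath

variable {G X : Type*} [Group G] [MulAction G X] [Finite X] {S : Submonoid (Function.End X)}

/-- If `S` contains all relabellings and all twists of the representatives `x i` of the orbits
of points with stabilizer `H`, it contains all automorphisms fixing the other points. -/
theorem mem_of_relabel_mem_of_twist_mem (hG : IsDedekindGroup G) {H : Subgroup G}
    {ι : Type*} [Finite ι] {x : ι → X} (hx : OrbitIndependent G x) (hH : ∀ i, stabilizer G (x i) = H)
    (hcov : ∀ u : X, stabilizer G u = H → ∃ i, ∃ g : G, g • x i = u)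
    (hr : ∀ p : Equiv.Perm ι, relabel G x p ∈ S) (ht : ∀ i (g : G), twist G (x i) g ∈ S)
    {φ : Function.End X} (hφ : φ ∈ equivariantEnd G X) (hi : Function.Injective φ)
    (hoff : ∀ u, stabilizer G u ≠ H → φ u = u) : φ ∈ S := by
  classical
  have hs : ∀ i j, stabilizer G (x i) = stabilizer G (x j) := fun i j => by rw [hH, hH]
  have hne : ∀ {u}, stabilizer G u ≠ H → ∀ i (g : G), g • x i ≠ u := by
    rintro u hu i g rfl
    exact hu (by rw [stabilizer_smul_of_normal hG, hH])
  generalize hn : {i | φ (x i) ≠ x i}.ncard = n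
  induction n using Nat.strong_induction_on generalizing φ with
  | _ n ih =>
  by_cases hfix : ∀ i, φ (x i) = x i
  · suffices φ = 1 from this ▸ one_mem S
    refine equivariantEnd_ext hφ (one_mem _) x hfix fun u hu => hoff u fun h => ?_
    obtain ⟨i, g, hg⟩ := hcov u h
    exact hu i g hg
  push Not at hfix
  obtain ⟨i, hmv⟩ := hfix
  obtain ⟨j, g, hg⟩ := hcov (φ (x i)) (by rw [stabilizer_eq_of_injective hφ hi, hH])
  have hr' := relabel_injective hx hs (Equiv.swap i j)
  have ht' := twist_injective hG (x j) g⁻¹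
  -- Since `φ` sends `x i` to `g • x j`, twisting back by `g⁻¹` and swapping `i` with `j` fixes `x
  -- i` and disturbs no representative already fixed. The number of moved representatives drops.
  refine mem_of_mul_mem_of_left ht' (ht j _) (mem_of_mul_mem_of_left hr' (hr (Equiv.swap i j)) ?_)
  have hψi : (relabel G x (Equiv.swap i j) * (twist G (x j) g⁻¹ * φ)) (x i) = x i := by
    rw [end_mul_apply, end_mul_apply, ← hg, twist_smul hG, smul_inv_smul, relabel_apply hx hs,
      Equiv.swap_apply_right]
  refine ih _ ?_ (mul_mem (relabel_mem hx hs _) (mul_mem (twist_mem hG _ _) hφ))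
    (injective_mul hr' (injective_mul ht' hi)) (fun u hu => ?_) rfl
  · rw [← hn]
    refine Set.ncard_lt_ncard (Set.ssubset_iff_of_subset ?_ |>.mpr ⟨i, hmv, by simpa using hψi⟩)
      (Set.toFinite _)
    intro l hl hl'
    by_cases hli : l = i
    · exact hmv (hli ▸ hl')
    have hlj : l ≠ j := by
      rintro rfl
      have : φ (g • x l) = φ (x i) := by rw [hφ, hl', hg]
      exact hli (hx l i g (hi this))
    refine hl ?_
    rw [end_mul_apply, end_mul_apply, hl', twist_of_ne g⁻¹ fun k hk => hlj (hx j l k hk).symm,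
      relabel_apply hx hs, Equiv.swap_apply_of_ne_of_ne hli hlj]
  · rw [end_mul_apply, end_mul_apply, hoff u hu, twist_of_ne g⁻¹ (hne hu j),
      relabel_of_ne _ (hne hu)]

/-- The wreath product of `G ⧸ H` with a symmetric group, in its action on the points with
stabilizer `H`, is generated by a twisted cycle, a transposition and twists of one orbit. -/
theorem mem_of_cycle_mem_of_swap_mem_of_twist_mem (hG : IsDedekindGroup G) {H : Subgroup G}
    {k : G} {Γ : Set G} (hgen : ∀ Q : Subgroup G, H ≤ Q → k ∈ Q → Γ ⊆ Q → Q = ⊤)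
    {m : ℕ} {x : Fin (m + 1) → X} (hx : OrbitIndependent G x)
    (hH : ∀ i, stabilizer G (x i) = H)
    (hcov : ∀ u : X, stabilizer G u = H → ∃ i, ∃ g : G, g • x i = u)
    (hcyc : relabel G x (finRotate (m + 1)) * twist G (x (Fin.last m)) k ∈ S)
    (hswap : 1 ≤ m → relabel G x (Equiv.swap 0 1) ∈ S)
    (htw : ∀ g ∈ Γ, twist G (x 0) g ∈ S)
    {φ : Function.End X} (hφ : φ ∈ equivariantEnd G X) (hi : Function.Injective φ)
    (hoff : ∀ u, stabilizer G u ≠ H → φ u = u) : φ ∈ S := by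
  have hs : ∀ i j, stabilizer G (x i) = stabilizer G (x j) := fun i j => by rw [hH, hH]
  -- Conjugating by the twisted cycle carries each adjacent transposition to the next.
  have hadj : ∀ (i : ℕ) (h : i < m),
      relabel G x (Equiv.swap (Fin.castSucc ⟨i, h⟩) (Fin.succ ⟨i, h⟩)) ∈ S := by
    intro i
    induction i with
    | zero =>
      intro h
      have h1 : Fin.succ ⟨0, h⟩ = (1 : Fin (m + 1)) := by
        rw [Fin.ext_iff, Fin.val_one', Nat.mod_eq_of_lt (by omega)]
        rfl
      rw [h1]
      exact hswap h
    | succ i ih =>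
      intro h
      have h0 := ih (by omega)
      set s := Equiv.swap (Fin.castSucc ⟨i, Nat.lt_of_succ_lt h⟩) (Fin.succ ⟨i, Nat.lt_of_succ_lt h⟩)
        with hsdef
      refine mem_of_mul_mem_of_right (injective_mul (relabel_injective hx hs (finRotate (m + 1)))
        (twist_injective hG (x (Fin.last m)) k)) hcyc ?_
      have hlast : s (Fin.last m) = Fin.last m := by
        refine Equiv.swap_apply_of_ne_of_ne ?_ ?_ <;>
        · intro h'
          have := congrArg Fin.val h'
          simp at this
          omega
      -- The twist lives on the last orbit, which `s` does not touch, so it does not spoil the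
      -- conjugation.
      have hc : twist G (x (Fin.last m)) k * relabel G x s =
          relabel G x s * twist G (x (Fin.last m)) k := by
        have := override_mul_eq_mul_override (relabel_mem hx hs s) (relabel_injective hx hs s)
          (.const (x (Fin.last m)))
          fun _ => (stabilizer_smul_of_normal hG k (x (Fin.last m))).ge
        simp only [relabel_smul hx hs, relabel_apply hx hs, hlast] at this
        exact this
      have hp : Equiv.swap (Fin.castSucc ⟨i + 1, h⟩) (Fin.succ ⟨i + 1, h⟩) * finRotate (m + 1) =
          finRotate (m + 1) * s := by
        rw [hsdef, Equiv.mul_swap_eq_swap_mul]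
        congr 2
        · ext
          rw [coe_finRotate_of_ne_last (by simp [Fin.ext_iff]; omega)]
          rfl
        · ext
          rw [coe_finRotate_of_ne_last (by simp [Fin.ext_iff]; omega)]
          rfl
      rw [← mul_assoc, ← relabel_mul hx hs, hp, relabel_mul hx hs, mul_assoc, ← hc, ← mul_assoc]
      exact mul_mem hcyc h0
  have hr : ∀ p : Equiv.Perm (Fin (m + 1)), relabel G x p ∈ S := by
    intro p
    have hp : p ∈ Submonoid.closure (Set.range fun i : Fin m => Equiv.swap i.castSucc i.succ) := by
      rw [Equiv.Perm.mclosure_swap_castSucc_succ]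
      trivial
    induction hp using Submonoid.closure_induction with
    | mem p hp =>
      obtain ⟨i, rfl⟩ := hp
      exact hadj i i.2
    | one => exact relabel_one hx hs ▸ one_mem S
    | mul p q _ _ hp hq => exact relabel_mul hx hs p q ▸ mul_mem hp hq
  -- With all permutations available, the cycle cancels and leaves the twist by `k`.
  have hk := mem_of_mul_mem_of_left (relabel_injective hx hs _) (hr _) hcyc
  have hmove : ∀ {i : Fin (m + 1)} {g : G}, twist G (x i) g ∈ S → ∀ j, twist G (x j) g ∈ S := by
    intro i g h j
    have := twist_comp_mem hG (x i) (relabel_mem hx hs (Equiv.swap i j))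
      (relabel_injective hx hs _) (hr _) h
    rwa [relabel_apply hx hs, Equiv.swap_apply_left] at this
  -- The elements whose twists all lie in `S`. Twists by elements of `H` are trivial, so `Q`
  -- contains `H`, `k` and `Γ`.
  let Q : Subgroup G :=
    { carrier := {g | ∀ i, twist G (x i) g ∈ S}
      one_mem' := fun i => by rw [twist_of_mem _ (one_mem _)]; exact one_mem S
      mul_mem' := fun {g h} hg hh i => by
        rw [← twist_mul_twist hG]
        exact mul_mem (hh i) (hg i)
      inv_mem' := fun {g} hg i => by
        refine mem_of_mul_mem_of_left (twist_injective hG (x i) g) (hg i) ?_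
        rw [twist_mul_twist hG, inv_mul_cancel, twist_of_mem _ (one_mem _)]
        exact one_mem S }
  have hQ : Q = ⊤ := by
    refine hgen Q (fun g hg i => ?_) (hmove hk) fun g hg => hmove (htw g hg)
    rw [twist_of_mem _ (by rwa [hH])]
    exact one_mem S
  exact mem_of_relabel_mem_of_twist_mem hG hx hH hcov hr
    (fun i g => (hQ ▸ Subgroup.mem_top g : g ∈ Q) i) hφ hi hoff

/-- The orbits of points with a given stabilizer have a finite family of representatives. -/
theorem exists_orbit_representatives (hG : IsDedekindGroup G) (H : Subgroup G) :
    ∃ (n : ℕ) (x : Fin n → X), OrbitIndependent G x ∧ (∀ i, stabilizer G (x i) = H) ∧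
      ∀ u : X, stabilizer G u = H → ∃ i, ∃ g : G, g • x i = u := by
  let Ω := {q : orbitRel.Quotient G X // stabilizer G q.out = H}
  have : Finite (orbitRel.Quotient G X) := Quotient.finite _
  obtain ⟨n, ⟨e⟩⟩ := Finite.exists_equiv_fin Ω
  refine ⟨n, fun i => (e.symm i).1.out, fun i j g h => ?_, fun i => (e.symm i).2, fun u hu => ?_⟩
  · apply e.symm.injective
    apply Subtype.ext
    refine (Quotient.out_equiv_out (s := orbitRel G X)).mp (orbitRel_apply.mpr ⟨g⁻¹, ?_⟩)
    dsimp only at h ⊢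
    rw [← h, inv_smul_smul]
  · have h : orbitRel G X u (Quotient.out (Quotient.mk (orbitRel G X) u)) :=
      (orbitRel G X).symm (Quotient.mk_out (s := orbitRel G X) u)
    obtain ⟨g, hg⟩ := orbitRel_apply.mp h
    dsimp only at hg
    refine ⟨e ⟨Quotient.mk (orbitRel G X) u, ?_⟩, g, ?_⟩
    · rw [← hu]
      conv_rhs => rw [← hg]
      exact (stabilizer_smul_of_normal hG _ _).symm
    · simpa using hg

end Wreath

/-! ### Generation by automorphisms and collapses -/

section Generation

variable {G X : Type*} [Group G] [MulAction G X] [Finite X]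

omit [Finite X] in
/-- Every automorphism is a product of automorphisms that each move only points with one given
stabilizer. -/
theorem injective_mem_of_forall_stabilizer [Finite G] (hG : IsDedekindGroup G)
    {S : Submonoid (Function.End X)}
    (hS : ∀ (H : Subgroup G), ∀ φ ∈ equivariantEnd G X, Function.Injective φ →
      (∀ u, stabilizer G u ≠ H → φ u = u) → φ ∈ S)
    {φ : Function.End X} (hφ : φ ∈ equivariantEnd G X) (hi : Function.Injective φ) : φ ∈ S := by
  classical
  have := Fintype.ofFinite (Subgroup G)
  suffices ∀ (s : Finset (Subgroup G)), ∀ φ ∈ equivariantEnd G X, Function.Injective φ →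
      (∀ u, stabilizer G u ∉ s → φ u = u) → φ ∈ S from
    this Finset.univ φ hφ hi fun u hu => absurd (Finset.mem_univ _) hu
  intro s
  induction s using Finset.induction_on with
  | empty =>
    intro φ _ _ h
    suffices φ = 1 from this ▸ one_mem S
    exact funext fun u => h u (Finset.notMem_empty _)
  | insert H s _ ih =>
    intro φ hφ hi h
    have hst := stabilizer_eq_of_injective hφ hi
    -- Automorphisms preserve stabilizers, so `φ` splits into its part `α` on the stratum of `H` and
    -- its part `β` elsewhere.
    let α : Function.End X := fun u => if stabilizer G u = H then φ u else u
    let β : Function.End X := fun u => if stabilizer G u = H then u else φ u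
    have hα : ∀ u, α u = if stabilizer G u = H then φ u else u := fun _ => rfl
    have hβ : ∀ u, β u = if stabilizer G u = H then u else φ u := fun _ => rfl
    have hsα : ∀ u, stabilizer G (α u) = stabilizer G u := by
      intro u
      rw [hα]
      split_ifs <;> simp [hst]
    have hsβ : ∀ u, stabilizer G (β u) = stabilizer G u := by
      intro u
      rw [hβ]
      split_ifs <;> simp [hst]
    have hαE : α ∈ equivariantEnd G X := by
      intro g u
      rw [hα, hα, stabilizer_smul_of_normal hG, hφ]
      split_ifs <;> rfl
    have hβE : β ∈ equivariantEnd G X := by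
      intro g u
      rw [hβ, hβ, stabilizer_smul_of_normal hG, hφ]
      split_ifs <;> rfl
    have hαi : Function.Injective α := by
      intro u v huv
      have he := hsα u
      rw [huv, hsα] at he
      rw [hα, hα, he] at huv
      split_ifs at huv
      · exact hi huv
      · exact huv
    have hβi : Function.Injective β := by
      intro u v huv
      have he := hsβ u
      rw [huv, hsβ] at he
      rw [hβ, hβ, he] at huv
      split_ifs at huv
      · exact huv
      · exact hi huv
    have hαβ : φ = α * β := by
      funext u
      rw [end_mul_apply, hα, hsβ, hβ]
      split_ifs <;> rfl
    rw [hαβ]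
    refine mul_mem (hS H α hαE hαi fun u hu => by rw [hα, if_neg hu]) (ih β hβE hβi fun u hu => ?_)
    rw [hβ]
    split_ifs with hH
    · rfl
    · exact h u (by simp [hH, hu])

/-- The endomorphisms of a finite `G`-set are generated by its automorphisms and the maps that
collapse one orbit onto another. -/
theorem mem_of_injective_mem_of_collapse_mem [Finite G] (hG : IsDedekindGroup G)
    {S : Submonoid (Function.End X)}
    (hinj : ∀ φ ∈ equivariantEnd G X, Function.Injective φ → φ ∈ S)
    (hcol : ∀ x y : X, stabilizer G x ≤ stabilizer G y → (∀ g : G, g • x ≠ y) → collapse G x y ∈ S)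
    {τ : Function.End X} (hτ : τ ∈ equivariantEnd G X) : τ ∈ S := by
  classical
  have := Fintype.ofFinite X
  -- Lexicographic measure: total size of the stabilizers of the values, then the number of missed
  -- points.
  let μ : Function.End X → ℕ ×ₗ ℕ := fun σ =>
    toLex (∑ u, Nat.card (stabilizer G (σ u)), (Set.range σ)ᶜ.ncard)
  induction hm : μ τ using WellFoundedLT.induction generalizing τ with
  | _ a ih =>
  subst hm
  by_cases hi : Function.Injective τ
  · exact hinj τ hτ hi
  have hns : ∃ z, z ∉ Set.range τ := by
    by_contra! h
    exact hi (Finite.injective_iff_surjective.mpr h)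
  obtain ⟨z, hz, hmin⟩ := Set.exists_min_image {z | z ∉ Set.range τ}
    (fun z => Nat.card (stabilizer G z)) (Set.toFinite _) hns
  have hzg : ∀ (u : X) (g : G), τ u ≠ g • z := by
    intro u g h
    exact hz ⟨g⁻¹ • u, by rw [hτ, h, inv_smul_smul]⟩
  set H := stabilizer G z with hH
  let Y : Set X := {u | Nat.card (stabilizer G u) < Nat.card H}
  have hpre : ∀ u, τ u ∈ Y → u ∈ Y := fun u hu =>
    lt_of_le_of_lt (Subgroup.card_le_of_le (stabilizer_le_of_equivariant hτ u)) hu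
  have hYim : Y ⊆ τ '' (τ ⁻¹' Y) := by
    intro u hu
    by_contra! hc
    refine absurd (hmin u ?_) (not_le.mpr hu)
    rintro ⟨v, rfl⟩
    exact hc ⟨v, hu, rfl⟩
  have hYeq : τ ⁻¹' Y = Y := by
    refine Set.eq_of_subset_of_ncard_le hpre ?_ (Set.toFinite _)
    exact (Set.ncard_le_ncard hYim (Set.toFinite _)).trans (Set.ncard_image_le (Set.toFinite _))
  -- the points with stabilizer `H` are only hit by points with stabilizer `H`
  have hback : ∀ u, stabilizer G (τ u) = H → stabilizer G u = H := by
    intro u hu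
    have hle : stabilizer G u ≤ H := hu ▸ stabilizer_le_of_equivariant hτ u
    refine Subgroup.eq_of_le_of_card_ge hle (not_lt.mp fun hlt => ?_)
    have : Nat.card (stabilizer G (τ u)) < Nat.card H := hYeq.ge hlt
    rw [hu] at this
    exact this.ne rfl
  -- Otherwise `τ` would map the finite stratum of `H` injectively to itself, hence onto it, and
  -- would hit `z`.
  obtain ⟨x, hx, hxτ⟩ : ∃ x, stabilizer G x = H ∧ (stabilizer G (τ x) ≠ H ∨
      ∃ y, (∀ g : G, g • x ≠ y) ∧ τ y = τ x) := by
    by_contra! hno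
    let X' := {u : X // stabilizer G u = H}
    let τ' : X' → X' := fun u => ⟨τ u.1, (hno u.1 u.2).1⟩
    have hinj' : Function.Injective τ' := by
      intro u v huv
      have huv' : τ u.1 = τ v.1 := congrArg Subtype.val huv
      by_contra hne
      obtain ⟨g, hg⟩ : ∃ g : G, g • u.1 = v.1 := by
        by_contra! hg
        exact (hno u.1 u.2).2 v.1 hg huv'.symm
      rw [← hg, hτ] at huv'
      have : g ∈ stabilizer G (τ u.1) := huv'.symm
      rw [(hno u.1 u.2).1, ← u.2, mem_stabilizer_iff, hg] at this
      exact hne (Subtype.ext this.symm)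
    obtain ⟨u, hu⟩ := Finite.surjective_of_injective hinj' ⟨z, rfl⟩
    exact hz ⟨u.1, congrArg Subtype.val hu⟩
  -- Send the orbit of `x` to the missed orbit of `z` instead. As `τ` has no value on that orbit,
  -- collapsing `z` onto `τ x` afterwards recovers `τ`.
  let σ := override G τ (fun _ : Unit => x) (fun _ => z)
  have hle : ∀ _ : Unit, stabilizer G x ≤ stabilizer G z := fun _ => by rw [hx]
  have hσ : σ ∈ equivariantEnd G X := override_mem hτ (.const x) hle
  have hσx : ∀ g : G, σ (g • x) = g • z := fun g => override_smul τ (.const x) hle g ()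
  have hσu : ∀ u, (∀ g : G, g • x ≠ u) → σ u = τ u := fun u hu =>
    override_of_forall_ne τ _ _ fun _ => hu
  have hzw : stabilizer G z ≤ stabilizer G (τ x) := by
    rw [← hH, ← hx]
    exact stabilizer_le_of_equivariant hτ x
  have hfac : τ = collapse G z (τ x) * σ := by
    refine equivariantEnd_ext hτ (mul_mem (collapse_mem hzw) hσ) (fun _ : Unit => x)
      (fun _ => ?_) fun u hu => ?_
    · rw [end_mul_apply, show σ x = z by simpa using hσx 1, collapse_apply hzw]
    · rw [end_mul_apply, hσu u (hu ()), collapse_of_ne fun g h => hzg u g h.symm]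
  have hcard : ∀ u, Nat.card (stabilizer G (σ u)) ≤ Nat.card (stabilizer G (τ u)) := by
    intro u
    by_cases hu : ∃ g : G, g • x = u
    · obtain ⟨g, rfl⟩ := hu
      rw [hσx, hτ, stabilizer_smul_of_normal hG, stabilizer_smul_of_normal hG]
      exact Subgroup.card_le_of_le hzw
    · push Not at hu
      rw [hσu u hu]
  have hlt : μ σ < μ τ := by
    -- If `τ` enlarged the stabilizer of `x`, the first component drops. Otherwise it does not grow,
    -- and the image gains `z` while losing nothing, since `y` still reaches `τ x`.
    rcases hxτ with hxτ | ⟨y, hxy, hy⟩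
    · refine Prod.Lex.toLex_lt_toLex.mpr (Or.inl ?_)
      refine Finset.sum_lt_sum (fun u _ => hcard u) ⟨x, Finset.mem_univ _, ?_⟩
      refine lt_of_le_of_ne (hcard x) fun he => hxτ ?_
      rw [show σ x = z by simpa using hσx 1] at he
      exact (Subgroup.eq_of_le_of_card_ge hzw he.ge).symm
    · refine Prod.Lex.toLex_lt_toLex.mpr ?_
      rcases (Finset.sum_le_sum fun u (_ : u ∈ Finset.univ) => hcard u).lt_or_eq with h | h
      · exact Or.inl h
      refine Or.inr ⟨h, Set.ncard_lt_ncard ?_ (Set.toFinite _)⟩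
      refine compl_lt_compl_iff_lt.mpr ?_
      refine Set.ssubset_iff_of_subset ?_ |>.mpr ⟨z, ⟨x, by simpa using hσx 1⟩, hz⟩
      rintro _ ⟨u, rfl⟩
      by_cases hu : ∃ g : G, g • x = u
      · obtain ⟨g, rfl⟩ := hu
        refine ⟨g • y, ?_⟩
        rw [hσ, hτ, hσu y hxy, hy]
      · push Not at hu
        exact ⟨u, hσu u hu⟩
  rw [hfac]
  exact mul_mem (hcol z (τ x) hzw fun g h => hzg x g h.symm) (ih _ hlt hσ rfl)

/-- A single map collapsing an orbit with stabilizer `H` onto an orbit with stabilizer `K`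
yields all of them by composition with automorphisms. -/
theorem exists_finset_collapse (hG : IsDedekindGroup G) {H K : Subgroup G} (hHK : H ≤ K) :
    ∃ C : Finset (Function.End X), (C : Set (Function.End X)) ⊆ equivariantEnd G X ∧ C.card ≤ 1 ∧
      ((∀ x y : X, stabilizer G x = H → stabilizer G y = K → ∃ g : G, g • x = y) → C.card ≤ 0) ∧
      ∀ S : Submonoid (Function.End X), (C : Set (Function.End X)) ⊆ S →
        (∀ φ ∈ equivariantEnd G X, Function.Injective φ → φ ∈ S) →
        ∀ x y : X, stabilizer G x = H → stabilizer G y = K → (∀ g : G, g • x ≠ y) →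
          collapse G x y ∈ S := by
  by_cases h : ∀ x y : X, stabilizer G x = H → stabilizer G y = K → ∃ g : G, g • x = y
  · refine ⟨∅, by simp, by simp, by simp, fun S _ _ x y hx hy hxy => ?_⟩
    obtain ⟨g, hg⟩ := h x y hx hy
    exact absurd hg (hxy g)
  have h' := h
  push Not at h'
  obtain ⟨x₀, y₀, hx₀, hy₀, hne₀⟩ := h'
  have hle : stabilizer G x₀ ≤ stabilizer G y₀ := by rwa [hx₀, hy₀]
  refine ⟨{collapse G x₀ y₀}, by simpa using collapse_mem hle, by simp, fun h' => absurd h' h,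
    fun S hC hS x y hx hy hne => ?_⟩
  have hc : collapse G x₀ y₀ ∈ S := hC (by simp)
  obtain ⟨φ, hφ, hφi, hφx, -⟩ := exists_automorphism_apply_eq hG (hx₀.trans hx.symm)
  have hst := stabilizer_eq_of_injective hφ hφi
  have hc' := collapse_comp_mem hle hφ hφi (hS φ hφ hφi) hc
  -- After `φ` has moved the source to `x`, `ψ` corrects the target; it fixes `x`, which lies off
  -- both orbits it exchanges.
  obtain ⟨ψ, hψ, hψi, hψy, hψf⟩ := exists_automorphism_apply_eq hG
    (show stabilizer G (φ y₀) = stabilizer G y by rw [hst, hy₀, hy])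
  have hc'' := collapse_comp_mem (by rw [hst, hst]; exact hle) hψ hψi (hS ψ hψ hψi) hc'
  rwa [hψy, hφx, hψf x (fun g hg => ?_) (fun g hg => ?_)] at hc''
  · rw [← hφx, ← hφ] at hg
    exact hne₀ g⁻¹ (inv_smul_eq_iff.mpr (hφi hg).symm)
  · exact hne g⁻¹ (inv_smul_eq_iff.mpr hg.symm)

/-- Generators for the automorphisms moving only points with stabilizer `H`, when `G` is generated
by `H`, an element `k` and a set `Γ`. -/
theorem exists_finset_automorphism (hG : IsDedekindGroup G) {H : Subgroup G} {k : G} {Γ : Finset G}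
    (hgen : ∀ Q : Subgroup G, H ≤ Q → k ∈ Q → (Γ : Set G) ⊆ Q → Q = ⊤) :
    ∃ T : Finset (Function.End X), (T : Set (Function.End X)) ⊆ equivariantEnd G X ∧
      T.card ≤ Γ.card + 2 ∧
      ((∀ x y : X, stabilizer G x = H → stabilizer G y = H → ∃ g : G, g • x = y) →
        T.card ≤ Γ.card + 1) ∧
      ∀ S : Submonoid (Function.End X), (T : Set (Function.End X)) ⊆ S →
        ∀ φ ∈ equivariantEnd G X, Function.Injective φ →
          (∀ u, stabilizer G u ≠ H → φ u = u) → φ ∈ S := by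
  classical
  obtain ⟨n, x, hx, hH, hcov⟩ := exists_orbit_representatives (X := X) hG H
  have hs : ∀ i j, stabilizer G (x i) = stabilizer G (x j) := fun i j => by rw [hH, hH]
  obtain _ | m := n
  · refine ⟨∅, by simp, by simp, by simp, fun S _ φ _ _ hoff => ?_⟩
    suffices φ = 1 from this ▸ one_mem S
    exact funext fun u => hoff u fun hu => (hcov u hu).choose.elim0
  let y := relabel G x (finRotate (m + 1)) * twist G (x (Fin.last m)) k
  have hy : y ∈ equivariantEnd G X := mul_mem (relabel_mem hx hs _) (twist_mem hG _ _)
  let T₀ := insert y (Γ.image (twist G (x 0)))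
  have hT₀ : (T₀ : Set (Function.End X)) ⊆ equivariantEnd G X := by
    intro τ hτ
    simp only [T₀, Finset.coe_insert, Finset.coe_image] at hτ
    obtain rfl | ⟨g, -, rfl⟩ := hτ
    · exact hy
    · exact twist_mem hG _ _
  have hcard : T₀.card ≤ Γ.card + 1 :=
    (Finset.card_insert_le _ _).trans (Nat.succ_le_succ Finset.card_image_le)
  have key : ∀ S : Submonoid (Function.End X), (T₀ : Set (Function.End X)) ⊆ S →
      (1 ≤ m → relabel G x (Equiv.swap 0 1) ∈ S) → ∀ φ ∈ equivariantEnd G X,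
      Function.Injective φ → (∀ u, stabilizer G u ≠ H → φ u = u) → φ ∈ S := by
    intro S hS hswap φ hφ hi hoff
    refine mem_of_cycle_mem_of_swap_mem_of_twist_mem hG hgen hx hH hcov (hS ?_) hswap
      (fun g hg => hS ?_) hφ hi hoff
    · simp [T₀, y]
    · exact Finset.mem_insert_of_mem (Finset.mem_image_of_mem _ hg)
  -- With a single orbit the cycle is trivial: `y` is just the twist by `k`, and no transposition is
  -- needed.
  by_cases hm : 1 ≤ m
  · refine ⟨insert (relabel G x (Equiv.swap 0 1)) T₀, ?_, ?_, fun hone => ?_, fun S hS => ?_⟩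
    · rw [Finset.coe_insert]
      exact Set.insert_subset (relabel_mem hx hs _) hT₀
    · exact (Finset.card_insert_le _ _).trans (Nat.succ_le_succ hcard)
    · obtain ⟨g, hg⟩ := hone (x 0) (x (Fin.last m)) (hH _) (hH _)
      have := congrArg Fin.val (hx _ _ g hg)
      simp only [Fin.val_zero, Fin.val_last] at this
      omega
    · exact key S (subset_trans (by simp) hS) fun _ => hS (by simp)
  · exact ⟨T₀, hT₀, hcard.trans (Nat.le_succ _), fun _ => hcard,
      fun S hS => key S hS fun h => absurd h hm⟩

/-- If at most two points have stabilizer `H`, one automorphism generates those moving only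
points with stabilizer `H`. -/
theorem exists_finset_automorphism_of_two_points {H : Subgroup G}
    (htwo : ∀ a b c : X, stabilizer G a = H → stabilizer G b = H → stabilizer G c = H →
      a = b ∨ b = c ∨ a = c) :
    ∃ T : Finset (Function.End X), (T : Set (Function.End X)) ⊆ equivariantEnd G X ∧ T.card ≤ 1 ∧
      ∀ S : Submonoid (Function.End X), (T : Set (Function.End X)) ⊆ S →
        ∀ φ ∈ equivariantEnd G X, Function.Injective φ →
          (∀ u, stabilizer G u ≠ H → φ u = u) → φ ∈ S := by
  have : Finite (Function.End X) := inferInstanceAs (Finite (X → X))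
  let P : Set (Function.End X) := {φ | φ ∈ equivariantEnd G X ∧ Function.Injective φ ∧
    (∀ u, stabilizer G u ≠ H → φ u = u) ∧ φ ≠ 1}
  have key : ∀ φ ∈ P, ∀ w, stabilizer G w = H → stabilizer G (φ w) = H ∧ φ w ≠ w := by
    rintro φ ⟨hφ, hi, hoff, hne⟩ w hw
    have hst := stabilizer_eq_of_injective hφ hi
    refine ⟨by rw [hst, hw], fun hfix => hne (funext fun u => ?_)⟩
    by_contra hu
    change φ u ≠ u at hu
    have huH : stabilizer G u = H := by_contra fun h => hu (hoff u h)
    rcases htwo u (φ u) w huH ((hst u).trans huH) hw with h | h | h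
    · exact hu h.symm
    · exact hu (by rw [hi (h.trans hfix.symm), hfix])
    · exact hu (by rw [h, hfix])
  -- By `key`, a nontrivial such automorphism moves every point of the stratum, so it must exchange
  -- the two points.
  have hP : P.Subsingleton := by
    intro φ hφ ψ hψ
    funext u
    by_cases hu : stabilizer G u = H
    · obtain ⟨h1, h2⟩ := key φ hφ u hu
      obtain ⟨h3, h4⟩ := key ψ hψ u hu
      rcases htwo u (φ u) (ψ u) hu h1 h3 with h | h | h
      · exact absurd h.symm h2
      · exact h
      · exact absurd h.symm h4
    · rw [hφ.2.2.1 u hu, hψ.2.2.1 u hu]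
  refine ⟨(Set.toFinite P).toFinset, ?_, ?_, fun S hS φ hφ hi hoff => ?_⟩
  · rw [Set.Finite.coe_toFinset]
    exact fun φ hφ => hφ.1
  · exact Finset.card_le_one.mpr fun a ha b hb =>
      hP ((Set.Finite.mem_toFinset _).mp ha) ((Set.Finite.mem_toFinset _).mp hb)
  · by_cases h1 : φ = 1
    · exact h1 ▸ one_mem S
    · refine hS ?_
      rw [Set.Finite.coe_toFinset]
      exact ⟨hφ, hi, hoff, h1⟩

end Generation

/-! ### Assembling a generating set stratum by stratum -/

section Assembly

variable (G : Type*) {X : Type*} [Group G] [MulAction G X]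

/-- The set `T` generates the automorphisms that move only points with stabilizer `H` and, together
with all automorphisms, the maps collapsing one orbit of such points onto another. -/
def GeneratesAt (T : Finset (Function.End X)) (H : Subgroup G) : Prop :=
  (T : Set (Function.End X)) ⊆ equivariantEnd G X ∧
    ∀ S : Submonoid (Function.End X), (T : Set (Function.End X)) ⊆ S →
      (∀ φ ∈ equivariantEnd G X, Function.Injective φ →
        (∀ u, stabilizer G u ≠ H → φ u = u) → φ ∈ S) ∧
      ((∀ φ ∈ equivariantEnd G X, Function.Injective φ → φ ∈ S) →
        ∀ x y : X, stabilizer G x = H → stabilizer G y = H → (∀ g : G, g • x ≠ y) →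
          collapse G x y ∈ S)

variable {G} [Finite X]

/-- The cost is `Γ.card` twists, the twisted cycle, a transposition and a collapse; the last two
disappear when there is only one orbit. -/
theorem exists_generatesAt (hG : IsDedekindGroup G) {H : Subgroup G} {k : G} {Γ : Finset G}
    (hgen : ∀ Q : Subgroup G, H ≤ Q → k ∈ Q → (Γ : Set G) ⊆ Q → Q = ⊤) :
    ∃ T : Finset (Function.End X), GeneratesAt G T H ∧ T.card ≤ Γ.card + 3 ∧
      ((∀ x y : X, stabilizer G x = H → stabilizer G y = H → ∃ g : G, g • x = y) →
        T.card ≤ Γ.card + 1) := by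
  classical
  obtain ⟨T, hTE, hT, hT', hTS⟩ := exists_finset_automorphism (X := X) hG hgen
  obtain ⟨C, hCE, hC, hC', hCS⟩ := exists_finset_collapse (X := X) hG (le_refl H)
  refine ⟨T ∪ C, ⟨?_, fun S hS => ?_⟩, ?_, fun h => ?_⟩
  · rw [Finset.coe_union]
    exact Set.union_subset hTE hCE
  · rw [Finset.coe_union, Set.union_subset_iff] at hS
    exact ⟨hTS S hS.1, hCS S hS.2⟩
  · have := Finset.card_union_le T C
    omega
  · have := Finset.card_union_le T C
    have := hT' h
    have := hC' h
    omega

theorem exists_generatesAt_of_two_points (hG : IsDedekindGroup G) {H : Subgroup G}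
    (htwo : ∀ a b c : X, stabilizer G a = H → stabilizer G b = H → stabilizer G c = H →
      a = b ∨ b = c ∨ a = c) :
    ∃ T : Finset (Function.End X), GeneratesAt G T H ∧ T.card ≤ 2 := by
  classical
  obtain ⟨T, hTE, hT, hTS⟩ := exists_finset_automorphism_of_two_points htwo
  obtain ⟨C, hCE, hC, -, hCS⟩ := exists_finset_collapse (X := X) hG (le_refl H)
  refine ⟨T ∪ C, ⟨?_, fun S hS => ?_⟩, ?_⟩
  · rw [Finset.coe_union]
    exact Set.union_subset hTE hCE
  · rw [Finset.coe_union, Set.union_subset_iff] at hS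
    exact ⟨hTS S hS.1, hCS S hS.2⟩
  · have := Finset.card_union_le T C
    omega

-- Each subgroup pays for its own stratum, and each strict inclusion pays for one collapse between
-- strata.
open Classical in
theorem exists_generating_finset [Finite G] [Fintype (Subgroup G)] (hG : IsDedekindGroup G)
    (w : Subgroup G → ℕ)
    (hw : ∀ H, ∃ T : Finset (Function.End X), GeneratesAt G T H ∧ T.card ≤ w H) :
    ∃ T : Finset (Function.End X), Submonoid.closure (T : Set (Function.End X)) =
      equivariantEnd G X ∧
      T.card ≤ ∑ H, w H +
        (Finset.univ.filter fun p : Subgroup G × Subgroup G => p.1 < p.2).card := by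
  choose T hT hTw using hw
  have hc : ∀ p : Subgroup G × Subgroup G, ∃ C : Finset (Function.End X), p.1 < p.2 →
      (C : Set (Function.End X)) ⊆ equivariantEnd G X ∧ C.card ≤ 1 ∧
      ∀ S : Submonoid (Function.End X), (C : Set (Function.End X)) ⊆ S →
        (∀ φ ∈ equivariantEnd G X, Function.Injective φ → φ ∈ S) →
        ∀ x y : X, stabilizer G x = p.1 → stabilizer G y = p.2 → (∀ g : G, g • x ≠ y) →
          collapse G x y ∈ S := by
    intro p
    by_cases hp : p.1 < p.2
    · obtain ⟨C, h1, h2, -, h3⟩ := exists_finset_collapse (X := X) hG hp.le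
      exact ⟨C, fun _ => ⟨h1, h2, h3⟩⟩
    · exact ⟨∅, fun h => absurd h hp⟩
  choose C hC using hc
  set P := Finset.univ.filter fun p : Subgroup G × Subgroup G => p.1 < p.2
  have hP : ∀ {p}, p ∈ P ↔ p.1 < p.2 := by simp [P]
  refine ⟨Finset.univ.biUnion T ∪ P.biUnion C, le_antisymm ?_ fun τ hτ => ?_, ?_⟩
  · rw [Submonoid.closure_le]
    intro τ hτ
    simp only [Finset.coe_union, Finset.coe_biUnion, Set.mem_union, Set.mem_iUnion] at hτ
    obtain ⟨H, -, h⟩ | ⟨p, hp, h⟩ := hτ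
    · exact (hT H).1 h
    · exact (hC p (hP.mp hp)).1 h
  · have hTS : ∀ H, (T H : Set (Function.End X)) ⊆
        Submonoid.closure ((Finset.univ.biUnion T ∪ P.biUnion C : Finset (Function.End X)) :
          Set (Function.End X)) := fun H =>
      subset_trans (Finset.coe_subset.mpr ((Finset.subset_biUnion_of_mem T
        (Finset.mem_univ H)).trans Finset.subset_union_left)) Submonoid.subset_closure
    have hinj : ∀ φ ∈ equivariantEnd G X, Function.Injective φ → φ ∈
        Submonoid.closure ((Finset.univ.biUnion T ∪ P.biUnion C : Finset (Function.End X)) :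
          Set (Function.End X)) := fun φ hφ hi =>
      injective_mem_of_forall_stabilizer hG (fun H => ((hT H).2 _ (hTS H)).1) hφ hi
    refine mem_of_injective_mem_of_collapse_mem hG hinj (fun x y hle hne => ?_) hτ
    rcases hle.eq_or_lt with h | h
    · exact ((hT _).2 _ (hTS _)).2 hinj x y h rfl hne
    · refine (hC (stabilizer G x, stabilizer G y) h).2.2 _ ?_ hinj x y rfl rfl hne
      exact subset_trans (Finset.coe_subset.mpr ((Finset.subset_biUnion_of_mem C
        (hP.mpr h)).trans Finset.subset_union_right)) Submonoid.subset_closure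
  · refine (Finset.card_union_le _ _).trans (add_le_add ?_ ?_)
    · exact Finset.card_biUnion_le.trans (Finset.sum_le_sum fun H _ => hTw H)
    · refine (Finset.card_biUnion_le_card_mul P C 1 fun p hp => (hC p (hP.mp hp)).2.1).trans ?_
      rw [mul_one]

end Assembly

/-! ### Counting subgroups, inclusions and generators -/

section Counting

variable {G : Type*} [Group G]

theorem conjClass_eq_singleton (hG : IsDedekindGroup G) (H : Subgroup G) : conjClass H = {H} := by
  have := hG H
  ext K
  simp only [conjClass, Set.mem_ofPred_eq, Set.mem_singleton_iff]
  have h : ∀ g : G, H.map (MulAut.conj g⁻¹).toMonoidHom = H := fun g => by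
    exact Subgroup.Normal.map_conj_eq H g⁻¹
  simp only [h, exists_const]
  exact eq_comm

theorem numClassesOfIndex_eq (hG : IsDedekindGroup G) (i : ℕ) :
    numClassesOfIndex G i = {H : Subgroup G | H.index = i}.ncard := by
  unfold numClassesOfIndex
  simp only [conjClass_eq_singleton hG]
  exact Set.ncard_image_of_injective {H : Subgroup G | H.index = i} Set.singleton_injective

theorem numClasses_eq (hG : IsDedekindGroup G) : numClasses G = Nat.card (Subgroup G) := by
  unfold numClasses
  simp only [conjClass_eq_singleton hG]
  rw [← Set.ncard_univ, ← Set.ncard_image_of_injective Set.univ Set.singleton_injective,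
    Set.image_univ]
  rfl

open Classical in
theorem numClassesOfIndex_eq_card [Fintype (Subgroup G)] (hG : IsDedekindGroup G) (i : ℕ) :
    numClassesOfIndex G i = (Finset.univ.filter fun H : Subgroup G => H.index = i).card := by
  rw [numClassesOfIndex_eq hG, ← Set.ncard_coe_finset]
  simp

open Classical in
theorem numClassesOfPrimeIndex_eq_card [Finite G] [Fintype (Subgroup G)]
    (hG : IsDedekindGroup G) :
    numClassesOfPrimeIndex G =
      (Finset.univ.filter fun H : Subgroup G => H.index.Prime).card := by
  unfold numClassesOfPrimeIndex
  rw [Finset.card_eq_sum_card_fiberwise (f := Subgroup.index) (t := (Nat.card G).primeFactors)]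
  · refine Finset.sum_congr rfl fun p hp => ?_
    rw [numClassesOfIndex_eq_card hG, Finset.filter_filter]
    congr 1
    refine Finset.filter_congr fun H _ => ⟨fun h => ⟨h ▸ Nat.prime_of_mem_primeFactors hp, h⟩,
      fun h => h.2⟩
  · intro H hH
    simp only [Finset.coe_filter, Finset.mem_univ, true_and, Set.mem_ofPred_eq] at hH
    exact Nat.mem_primeFactors.mpr ⟨hH, H.index_dvd_card, Nat.card_pos.ne'⟩

-- Strictly ordered pairs and their reversals are disjoint and avoid the diagonal.
open Classical in
theorem two_mul_card_lt_pairs_le (α : Type*) [Fintype α] [PartialOrder α] :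
    2 * (Finset.univ.filter fun p : α × α => p.1 < p.2).card + Fintype.card α ≤
      Fintype.card α * Fintype.card α := by
  set P := Finset.univ.filter fun p : α × α => p.1 < p.2
  have h : (P ∪ P.map (Equiv.prodComm α α).toEmbedding).card = P.card + P.card := by
    rw [Finset.card_union_of_disjoint, Finset.card_map]
    rw [Finset.disjoint_left]
    rintro ⟨a, b⟩ h1 h2
    simp only [P, Finset.mem_filter, Finset.mem_univ, true_and, Finset.mem_map_equiv] at h1 h2
    exact lt_asymm h1 h2
  have h' : P ∪ P.map (Equiv.prodComm α α).toEmbedding ⊆ (Finset.univ : Finset α).offDiag := by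
    rintro ⟨a, b⟩ hab
    simp only [P, Finset.mem_union, Finset.mem_filter, Finset.mem_univ, true_and,
      Finset.mem_map_equiv] at hab
    simp only [Finset.mem_offDiag, Finset.mem_univ, true_and]
    rcases hab with h | h
    · exact h.ne
    · exact h.ne'
  have h'' := Finset.card_le_card h'
  rw [h, Finset.offDiag_card, Finset.card_univ] at h''
  have : Fintype.card α ≤ Fintype.card α * Fintype.card α := Nat.le_mul_self _
  omega

open Classical in
theorem card_filter_index_ne_one_and_not_prime [Finite G] [Fintype (Subgroup G)]
    (hG : IsDedekindGroup G) :
    ((Finset.univ.filter fun H : Subgroup G => H.index ≠ 1 ∧ ¬ H.index.Prime).card : ℚ) =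
      (numClasses G : ℚ) - numClassesOfPrimeIndex G - 1 := by
  have h1 : (Finset.univ.filter fun H : Subgroup G => H.index = 1) = {⊤} := by
    ext H
    simp
  have h2 : (Finset.univ.filter fun H : Subgroup G => H.index ≠ 1 ∧ ¬ H.index.Prime).card +
      ((Finset.univ.filter fun H : Subgroup G => H.index.Prime).card +
      (Finset.univ.filter fun H : Subgroup G => H.index = 1).card) =
      (Finset.univ : Finset (Subgroup G)).card := by
    rw [Finset.card_filter, Finset.card_filter, Finset.card_filter, Finset.card_eq_sum_ones,
      ← Finset.sum_add_distrib, ← Finset.sum_add_distrib]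
    refine Finset.sum_congr rfl fun H _ => ?_
    by_cases h : H.index = 1
    · simp [h, Nat.not_prime_one]
    · by_cases h' : H.index.Prime <;> simp [h, h']
  rw [h1, Finset.card_singleton, ← numClassesOfPrimeIndex_eq_card hG, Finset.card_univ,
    ← Nat.card_eq_fintype_card, ← numClasses_eq hG] at h2
  rw [← h2]
  push_cast
  ring

theorem monoidRank_le_card {M : Type*} [Monoid M] {N : Submonoid M} [Monoid.FG N] {T : Finset M}
    (hT : Submonoid.closure (T : Set M) = N) : monoidRank N ≤ T.card := by
  classical
  subst hT
  let T' := T.preimage ((↑) : Submonoid.closure (T : Set M) → M) Subtype.val_injective.injOn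
  have h : T'.card ≤ T.card :=
    Finset.card_le_card_of_injOn Subtype.val (fun a ha => Finset.mem_preimage.mp ha)
      Subtype.val_injective.injOn
  refine le_trans (Nat.sInf_le ⟨T', rfl, ?_⟩) h
  rw [Finset.coe_preimage]
  exact Submonoid.closure_closure_coe_preimage

end Counting

/-! ### Stabilizers in the full shift and the final count -/

section Shift

variable {G A : Type*} [Group G]

/-- The shift action of `G` on `A^G`. -/
abbrev shiftAction (G A : Type*) [Group G] : MulAction G (G → A) :=
  { smul := shift
    one_smul := fun x => funext fun h => congrArg x (by group)
    mul_smul := fun g k x => funext fun h => congrArg x (by group) }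

/-- A finite product of discrete spaces is discrete, so continuity is automatic. -/
theorem shiftEnd_eq_equivariantEnd [Finite G] [TopologicalSpace A] [DiscreteTopology A] :
    shiftEnd G A = @equivariantEnd G _ (G → A) (shiftAction G A) := by
  ext τ
  exact ⟨fun h => h.2, fun h => ⟨continuous_of_discreteTopology, h⟩⟩

theorem eq_or_eq_of_card_eq_two (hA : Nat.card A = 2) (a b c : A) : a = b ∨ b = c ∨ a = c := by
  obtain ⟨u, v, -, h⟩ := Nat.card_eq_two_iff.mp hA
  have h' : ∀ a : A, a = u ∨ a = v := fun a => by simpa using h.ge (Set.mem_univ a)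
  rcases h' a with rfl | rfl <;> rcases h' b with rfl | rfl <;> rcases h' c with rfl | rfl <;> simp

theorem eq_or_eq_of_shift_eq_self (hA : Nat.card A = 2) {x y z : G → A}
    (hx : ∀ g : G, shift g x = x) (hy : ∀ g : G, shift g y = y) (hz : ∀ g : G, shift g z = z) :
    x = y ∨ y = z ∨ x = z := by
  have hc : ∀ w : G → A, (∀ g : G, shift g w = w) → w = fun _ => w 1 := by
    intro w hw
    funext g
    have := congrFun (hw g) g
    simpa [shift] using this.symm
  rw [hc x hx, hc y hy, hc z hz]
  rcases eq_or_eq_of_card_eq_two hA (x 1) (y 1) (z 1) with h | h | h <;> simp [h]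

/-- Two binary configurations with the same stabilizer of index two are shifts of each other. -/
theorem exists_shift_eq_of_index_eq_two (hA : Nat.card A = 2) {H : Subgroup G} (hH : H.index = 2)
    {x y : G → A} (hx : ∀ g : G, shift g x = x ↔ g ∈ H) (hy : ∀ g : G, shift g y = y ↔ g ∈ H) :
    ∃ g : G, shift g x = y := by
  obtain ⟨s, hs⟩ : ∃ s, s ∉ H := by
    by_contra! h
    rw [(Subgroup.eq_top_iff' H).mpr h, Subgroup.index_top] at hH
    omega
  have hval : ∀ w : G → A, (∀ g : G, shift g w = w ↔ g ∈ H) →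
      (∀ g ∈ H, w g = w 1) ∧ (∀ g ∉ H, w g = w s) ∧ w 1 ≠ w s := by
    intro w hw
    have h1 : ∀ g ∈ H, w g = w 1 := fun g hg => by
      simpa [shift] using (congrFun ((hw g).mpr hg) g).symm
    have h2 : ∀ g ∉ H, w g = w s := fun g hg => by
      have hm : g * s⁻¹ ∈ H := by
        rw [Subgroup.mul_mem_iff_of_index_two hH, inv_mem_iff]
        tauto
      simpa [shift] using (congrFun ((hw _).mpr hm) g).symm
    refine ⟨h1, h2, fun h => hs ((hw s).mp ?_)⟩
    have hc : ∀ g, w g = w 1 := fun g => by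
      by_cases hg : g ∈ H
      · exact h1 g hg
      · rw [h2 g hg, h]
    funext g
    rw [shift, hc, hc g]
  obtain ⟨x1, x2, x3⟩ := hval x hx
  obtain ⟨y1, y2, y3⟩ := hval y hy
  have htwo := eq_or_eq_of_card_eq_two hA
  have hmem : ∀ t, s⁻¹ * t ∈ H ↔ t ∉ H := fun t => by
    rw [Subgroup.mul_mem_iff_of_index_two hH, inv_mem_iff]
    tauto
  -- Both configurations take two distinct values, one on `H` and one off it. With only two letters
  -- they are equal or have these values exchanged, and shifting by `s` exchanges the cosets.
  by_cases h : x 1 = y 1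
  · refine ⟨1, funext fun t => ?_⟩
    have h' : x s = y s := by
      rcases htwo (x s) (y s) (x 1) with h' | h' | h'
      · exact h'
      · exact absurd (h ▸ h').symm y3
      · exact absurd h'.symm x3
    rw [shift, inv_one, one_mul]
    by_cases ht : t ∈ H
    · rw [x1 t ht, y1 t ht, h]
    · rw [x2 t ht, y2 t ht, h']
  · have h1 : x s = y 1 := by
      rcases htwo (x s) (y 1) (x 1) with h' | h' | h'
      · exact h'
      · exact absurd h'.symm h
      · exact absurd h'.symm x3
    have h2 : x 1 = y s := by
      rcases htwo (x 1) (y s) (y 1) with h' | h' | h'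
      · exact h'
      · exact absurd h'.symm y3
      · exact absurd h' h
    refine ⟨s, funext fun t => ?_⟩
    rw [shift]
    by_cases ht : t ∈ H
    · rw [x2 _ (fun h' => (hmem t).mp h' ht), y1 t ht, h1]
    · rw [x1 _ ((hmem t).mpr ht), y2 t ht, h2]

/-- Multiplicativity of the index makes a subgroup of prime index maximal, so one twist replaces a
generating set of `G`. -/
theorem eq_top_of_index_prime {H Q : Subgroup G} (hH : H.index.Prime) (hle : H ≤ Q) {k : G}
    (hk : k ∈ Q) (hkH : k ∉ H) : Q = ⊤ := by
  have h := Subgroup.relIndex_mul_index hle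
  rcases (Nat.prime_mul_iff.mp (h ▸ hH)) with ⟨-, h1⟩ | ⟨-, h1⟩
  · exact Subgroup.index_eq_one.mp h1
  · exact absurd (Subgroup.relIndex_eq_one.mp h1 hk) hkH

variable [Finite G] [Finite A] [TopologicalSpace A] [DiscreteTopology A]

open Classical in
theorem monoidRank_shiftEnd_le [Fintype (Subgroup G)] (hG : IsDedekindGroup G) :
    monoidRank (shiftEnd G A) ≤ ∑ H : Subgroup G,
      (if H.index = 1 then (if Nat.card A = 2 then 2 else 3) else
        if H.index.Prime then (if Nat.card A = 2 ∧ H.index = 2 then 1 else 3) else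
          monoidRank G + 3) +
      (Finset.univ.filter fun p : Subgroup G × Subgroup G => p.1 < p.2).card := by
  let _ := shiftAction G A
  have hst : ∀ {x : G → A} {H : Subgroup G}, stabilizer G x = H → ∀ g, shift g x = x ↔ g ∈ H := by
    rintro x _ rfl g
    rfl
  suffices hw : ∀ H : Subgroup G, ∃ T : Finset (Function.End (G → A)), GeneratesAt G T H ∧
      T.card ≤ if H.index = 1 then (if Nat.card A = 2 then 2 else 3) else
        if H.index.Prime then (if Nat.card A = 2 ∧ H.index = 2 then 1 else 3) else
          monoidRank G + 3 by
    obtain ⟨T, hT, hcard⟩ := exists_generating_finset (X := G → A) hG _ hw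
    rw [← shiftEnd_eq_equivariantEnd] at hT
    exact (monoidRank_le_card hT).trans hcard
  intro H
  have hprime : H.index.Prime → ∃ T : Finset (Function.End (G → A)), GeneratesAt G T H ∧
      T.card ≤ 3 ∧ ((∀ x y : G → A, stabilizer G x = H → stabilizer G y = H →
        ∃ g : G, g • x = y) → T.card ≤ 1) := by
    intro hp
    obtain ⟨k, hk⟩ : ∃ k, k ∉ H := by
      by_contra! h
      exact hp.ne_one (Subgroup.index_eq_one.mpr ((Subgroup.eq_top_iff' H).mpr h))
    simpa using exists_generatesAt (X := G → A) hG (H := H) (k := k) (Γ := ∅)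
      fun Q hQ hkQ _ => eq_top_of_index_prime hp hQ hkQ hk
  split_ifs with h1 h2 hp h2
  · refine exists_generatesAt_of_two_points hG fun x y z hx hy hz => ?_
    have hm : ∀ g, g ∈ H := fun g => Subgroup.index_eq_one.mp h1 ▸ Subgroup.mem_top g
    exact eq_or_eq_of_shift_eq_self h2 (fun g => (hst hx g).mpr (hm g))
      (fun g => (hst hy g).mpr (hm g)) fun g => (hst hz g).mpr (hm g)
  · obtain ⟨T, hT, hc, -⟩ := exists_generatesAt (X := G → A) hG (H := H) (k := 1) (Γ := ∅)
      fun Q hQ _ _ => top_le_iff.mp (Subgroup.index_eq_one.mp h1 ▸ hQ)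
    exact ⟨T, hT, by simpa using hc⟩
  · obtain ⟨T, hT, -, hc⟩ := hprime hp
    exact ⟨T, hT, hc fun x y hx hy =>
      exists_shift_eq_of_index_eq_two h2.1 h2.2 (hst hx) (hst hy)⟩
  · obtain ⟨T, hT, hc, -⟩ := hprime hp
    exact ⟨T, hT, hc⟩
  · obtain ⟨Γ, hΓ, hgen⟩ := monoidRank_spec G
    obtain ⟨T, hT, hc, -⟩ := exists_generatesAt (X := G → A) hG (H := H) (k := 1) (Γ := Γ)
      fun Q _ _ hQ => by
        rw [← Subgroup.toSubmonoid_inj, Subgroup.top_toSubmonoid, ← top_le_iff, ← hgen]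
        exact Submonoid.closure_le.mpr hQ
    exact ⟨T, hT, hΓ ▸ hc⟩

theorem monoidRank_shiftEnd_le_of_card (hG : IsDedekindGroup G) :
    (monoidRank (shiftEnd G A) : ℚ) ≤
      ((numClasses G : ℚ) - numClassesOfPrimeIndex G - 1) * monoidRank G
        + 1 / 2 * numClasses G * (numClasses G + 5)
        - (if Nat.card A = 2 then 2 * (numClassesOfIndex G 2 : ℚ) + 1 else 0) := by
  classical
  have := Fintype.ofFinite (Subgroup G)
  have hle := monoidRank_shiftEnd_le (A := A) hG
  have hpairs := two_mul_card_lt_pairs_le (Subgroup G)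
  have hone : ((Finset.univ.filter fun H : Subgroup G => H.index = 1).card : ℚ) = 1 := by
    have : (Finset.univ.filter fun H : Subgroup G => H.index = 1) = {⊤} := by
      ext H
      simp
    rw [this, Finset.card_singleton, Nat.cast_one]
  have hr : (Fintype.card (Subgroup G) : ℚ) = numClasses G := by
    rw [numClasses_eq hG, Nat.card_eq_fintype_card]
  -- Each cost is 3, plus Rank(G) when the index is neither 1 nor prime, minus the binary savings: 2
  -- at index two and 1 at `H = ⊤`.
  have hterm : ∀ H : Subgroup G,
      (((if H.index = 1 then (if Nat.card A = 2 then 2 else 3) else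
        if H.index.Prime then (if Nat.card A = 2 ∧ H.index = 2 then 1 else 3) else
          monoidRank G + 3 : ℕ)) : ℚ) =
      3 + (if H.index ≠ 1 ∧ ¬ H.index.Prime then 1 else 0) * monoidRank G
        - (if Nat.card A = 2 then 2 * (if H.index = 2 then 1 else 0) +
            (if H.index = 1 then 1 else 0) else 0) := by
    intro H
    by_cases hA : Nat.card A = 2
    · by_cases h1 : H.index = 1
      · simp [h1, hA]
        norm_num
      · by_cases h2 : H.index = 2
        · simp [h2, hA, Nat.prime_two]
          norm_num
        · by_cases hp : H.index.Prime <;> simp [h1, h2, hA, hp, add_comm]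
    · by_cases h1 : H.index = 1
      · simp [h1, hA]
      · by_cases hp : H.index.Prime <;> simp [h1, hA, hp, add_comm]
  have hsum := card_filter_index_ne_one_and_not_prime hG
  have hle' : (monoidRank (shiftEnd G A) : ℚ) ≤ _ := Nat.cast_le.mpr hle
  rw [Nat.cast_add, Nat.cast_sum, Finset.sum_congr rfl fun H _ => hterm H, Finset.sum_sub_distrib,
    Finset.sum_add_distrib, ← Finset.sum_mul, Finset.sum_boole, hsum, Finset.sum_const,
    Finset.card_univ, nsmul_eq_mul, hr] at hle'
  have hloss : ∑ H : Subgroup G, (if Nat.card A = 2 then 2 * (if H.index = 2 then 1 else 0) +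
      (if H.index = 1 then 1 else 0) else (0 : ℚ)) =
      if Nat.card A = 2 then 2 * (numClassesOfIndex G 2 : ℚ) + 1 else 0 := by
    split_ifs
    · rw [Finset.sum_add_distrib, ← Finset.mul_sum, Finset.sum_boole, Finset.sum_boole, hone,
        numClassesOfIndex_eq_card hG]
    · simp
  rw [hloss] at hle'
  have hpairs' : (2 * ((Finset.univ.filter fun p : Subgroup G × Subgroup G => p.1 < p.2).card : ℚ)
      + numClasses G) ≤ numClasses G * numClasses G := by
    rw [← hr]
    exact_mod_cast hpairs
  linarith

end Shift

end FullShift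

theorem mainTheorem5 {G A : Type*} [Group G] [Finite G] (hG : FullShift.IsDedekindGroup G)
    [Finite A] [TopologicalSpace A] [DiscreteTopology A] (hA : 2 ≤ Nat.card A) :
    (Nat.card A = 2 →
      (FullShift.monoidRank (FullShift.shiftEnd G A) : ℚ) ≤
        ((FullShift.numClasses G : ℚ) - (FullShift.numClassesOfPrimeIndex G : ℚ) - 1) *
            (FullShift.monoidRank G : ℚ)
          + 1 / 2 * (FullShift.numClasses G : ℚ) * ((FullShift.numClasses G : ℚ) + 5)
          - 2 * (FullShift.numClassesOfIndex G 2 : ℚ) - 1) ∧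
    (Nat.card A ≠ 2 →
      (FullShift.monoidRank (FullShift.shiftEnd G A) : ℚ) ≤
        ((FullShift.numClasses G : ℚ) - (FullShift.numClassesOfPrimeIndex G : ℚ) - 1) *
            (FullShift.monoidRank G : ℚ)
          + 1 / 2 * (FullShift.numClasses G : ℚ) * ((FullShift.numClasses G : ℚ) + 5)) := by
  have h := FullShift.monoidRank_shiftEnd_le_of_card (A := A) hG
  refine ⟨fun h2 => ?_, fun h2 => ?_⟩
  · rw [if_pos h2] at h
    linarith
  · rw [if_neg h2] at h
    linarith
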